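/- Let $F$ be a finite field with $q$ elements, let $G$ be a finite abelian group of order $m$, and let $FG$ be the group algebra. An element $(a_1,\dots,a_n)\in(FG)^n$ with $a_i=\sum_{z\in G}a_{iz}z$ is identified with the word of length $mn$ over $F$ with entries $a_{iz}$; its Hamming weight is the number of nonzero $a_{iz}$. For a nonzero $FG$-submodule $C\subseteq(FG)^n$, let $\Delta(C)$ be the least Hamming weight of a nonzero element of $C$ divided by $mn$ (the relative distance); for $C=0$ put $\Delta(C)=+\infty$. Let $$h_q(x)=x\log_q(q-1)-x\log_q x-(1-x)\log_q(1-x)\quad(\text{with }0\log_q0=0),\qquad g_q(x)=1-h_q(x).$$ **Theorem 2.1.** Let $r\in(0,1)$ and $\delta\in(0,1-q^{-1})$, and for each $n\ge1$ let $k=k_n$ be the integer nearest to $rn$ (ties broken arbitrarily). Let $A$ be a uniformly distributed random $k\times n$ matrix over $FG$, and let $C_A=\{\mathbf bA\mid\mathbf b\in(FG)^k\}\subseteq(FG)^n$. Then $$\lim_{n\to\infty}\Pr\big(\Delta(C_A)>\delta\big)=\begin{cases}1,&\text{if } r<g_q(\delta);\\ 0,&\text{if } r>g_q(\delta),\end{cases}$$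 and in both cases the convergence is exponential: if $L\in\{0,1\}$ denotes the limit, there are constants $C$ and $c>0$ (independent of $n$) such that $|\Pr(\Delta(C_A)>\delta)-L|\le Ce^{-cn}$ for all $n\ge1$. -/

import Mathlib

open Filter Topology
open scoped ENNReal

noncomputable section

/-- The `q`-ary entropy function
`h_q(x) = x log_q (q-1) - x log_q x - (1-x) log_q (1-x)`.
Since `Real.logb q 0 = 0`, the convention `0 log_q 0 = 0` holds. -/
def qEntropy (q : ℕ) (x : ℝ) : ℝ :=
  x * Real.logb q ((q : ℝ) - 1) - x * Real.logb q x - (1 - x) * Real.logb q (1 - x)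

/-- The asymptotic Gilbert–Varshamov bound `g_q(x) = 1 - h_q(x)`. -/
def gvBound (q : ℕ) (x : ℝ) : ℝ := 1 - qEntropy q x

section Codes

variable {F G : Type*} [Field F] [DecidableEq F] [CommGroup G] [Fintype G]

/-- The Hamming weight of `(a_1, …, a_n) ∈ (FG)^n`: the sum over `i` of the Hamming weights of the
coefficient words `(a_{i z})_{z ∈ G}`. -/
def wordWeight {n : ℕ} (a : Fin n → MonoidAlgebra F G) : ℕ :=
  ∑ i, hammingNorm (fun z : G => (a i).coeff z)

/-- The minimum weight of a code `C ⊆ (FG)^n`, i.e. the least weight of a nonzero codeword.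
The zero code has no nonzero codeword, and its minimum weight is `⊤`. -/
def minWeight {n : ℕ} (C : Submodule (MonoidAlgebra F G) (Fin n → MonoidAlgebra F G)) : ℕ∞ :=
  ⨅ c ∈ {c | c ∈ C ∧ c ≠ 0}, (wordWeight c : ℕ∞)

/-- The relative distance `Δ(C) = w(C) / (m n)` of a code `C ⊆ (FG)^n`, where `m = |G|`. -/
def relativeDistance {n : ℕ}
    (C : Submodule (MonoidAlgebra F G) (Fin n → MonoidAlgebra F G)) : ℝ≥0∞ :=
  (minWeight C : ℝ≥0∞) / ((Fintype.card G * n : ℕ) : ℝ≥0∞)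

/-- The quasi-abelian code `C_A = {b A | b ∈ (FG)^k}` generated by a `k × n` matrix over `FG`. -/
def quasiAbelianCode {k n : ℕ} (A : Matrix (Fin k) (Fin n) (MonoidAlgebra F G)) :
    Submodule (MonoidAlgebra F G) (Fin n → MonoidAlgebra F G) :=
  LinearMap.range A.vecMulLinear

end Codes

/-- The probability `Pr(Δ(C_A) > δ)` for `A` uniformly distributed on the (finite) set of
`k × n` matrices over `FG`: the number of favourable matrices over the number of all matrices. -/
def probRelativeDistanceGT (F G : Type*) [Field F] [DecidableEq F] [CommGroup G] [Fintype G]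
    (k n : ℕ) (δ : ℝ) : ℝ :=
  (Set.ncard {A : Matrix (Fin k) (Fin n) (MonoidAlgebra F G) |
      ENNReal.ofReal δ < relativeDistance (quasiAbelianCode A)} : ℝ) /
    (Nat.card (Matrix (Fin k) (Fin n) (MonoidAlgebra F G)) : ℝ)

/-- The sequence `a` converges to `L` exponentially fast. -/
def ConvergesExponentially (a : ℕ → ℝ) (L : ℝ) : Prop :=
  ∃ C c : ℝ, 0 < c ∧ ∀ n : ℕ, 1 ≤ n → |a n - L| ≤ C * Real.exp (-c * n)

end

/-! Below the threshold the argument is a union bound. For fixed `b` generating an ideal `I` of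
dimension `d` over `F`, the word `bA` is uniform on `I ^ n`. An information set of `I` stays one
under translation by `G`, and its translates cover all coordinates equally often. A word of relative
weight at most `δ` is therefore that light on some translate, so `I ^ n` has at most `m q^(n d
h_q(δ))` such words (`ncard_wordWeight_le`). At most `q^(k d)` vectors generate `I`, so `I`
contributes at most `m q^(d (k - n g_q(δ)))`. This is exponentially small for each of the finitely
many nonzero ideals (`one_sub_probRelativeDistanceGT_le`).

Above the threshold a single ideal suffices: the line spanned by `∑ g`. On it `FG` acts through the
augmentation `ε`, so `C_A` contains the `m`-fold repetition of the code generated by `ε(A)`, with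
the same relative weights. Among the vectors `β` with a fixed coordinate equal to 1, the words `β
ε(A)` are uniform and pairwise independent. Chebyshev's inequality then bounds the probability that
none has weight `⌊δ n⌋` by the inverse of the expected number of such `β`
(`probRelativeDistanceGT_mul_le`). By the entropy estimate for binomials, that number grows
exponentially. -/

/-! ### Weight enumerator and volume of Hamming balls. -/

section HammingCounting

variable {ι F : Type*} [Fintype ι] [DecidableEq ι] [Field F] [Fintype F] [DecidableEq F]

/-- The weight enumerator of the full space `F ^ ι`. -/
theorem sum_pow_hammingNorm {R : Type*} [CommSemiring R] (t : R) :
    ∑ x : ι → F, t ^ hammingNorm x =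
      (1 + ((Fintype.card F - 1 : ℕ) : R) * t) ^ Fintype.card ι := by
  have h1 : ∀ x : ι → F, t ^ hammingNorm x = ∏ i, (if x i = 0 then 1 else t) := by
    intro x
    rw [hammingNorm, Finset.prod_ite]
    simp
  have h2 : ∑ a : F, (if a = 0 then (1 : R) else t) = 1 + ((Fintype.card F - 1 : ℕ) : R) * t := by
    rw [Finset.sum_ite]
    have : (Finset.univ.filter fun a : F => ¬ a = 0).card = Fintype.card F - 1 := by
      rw [Finset.filter_not, Finset.card_sdiff_of_subset (Finset.subset_univ _),
        Finset.filter_eq' Finset.univ (0 : F)]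
      simp
    simp [Finset.filter_eq', this]
  simp_rw [h1]
  rw [← h2, ← Finset.card_univ (α := ι), ← Finset.prod_const, Finset.prod_univ_sum,
    Fintype.piFinset_univ]

/-- Compare coefficients of `X ^ j` in the weight enumerator at `t = X`. -/
theorem card_hammingNorm_eq (j : ℕ) :
    (Finset.univ.filter fun x : ι → F => hammingNorm x = j).card =
      (Fintype.card ι).choose j * (Fintype.card F - 1) ^ j := by
  have h := congrArg (fun p : Polynomial ℕ => p.coeff j)
    (sum_pow_hammingNorm (ι := ι) (F := F) (Polynomial.X : Polynomial ℕ))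
  simp only [Polynomial.finsetSum_coeff, Polynomial.coeff_X_pow] at h
  rw [Finset.card_filter]
  simp_rw [eq_comm (a := hammingNorm _) (b := j)]
  rw [h, add_comm, ← Polynomial.C_eq_natCast, add_pow, Polynomial.finsetSum_coeff]
  simp only [one_pow, mul_one, mul_pow, ← Polynomial.C_pow]
  have : ∀ i, (Polynomial.C ((((Fintype.card F - 1 : ℕ) : ℕ)) ^ i) * Polynomial.X ^ i *
      (((Fintype.card ι).choose i : ℕ) : Polynomial ℕ)).coeff j =
      if j = i then (Fintype.card F - 1) ^ i * (Fintype.card ι).choose i else 0 := by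
    intro i
    rw [← Polynomial.C_eq_natCast, Polynomial.coeff_mul_C, Polynomial.coeff_C_mul,
      Polynomial.coeff_X_pow]
    split_ifs <;> simp
  simp only [Nat.cast_id] at this ⊢
  simp_rw [this]
  rw [Finset.sum_ite_eq]
  split_ifs with hj
  · ring
  · rw [Nat.choose_eq_zero_of_lt (by simpa using hj)]; simp

theorem qEntropy_mul_log {q : ℕ} (hq : 1 < q) (x : ℝ) :
    qEntropy q x * Real.log q = x * Real.log ((q : ℝ) - 1) + Real.binEntropy x := by
  have : Real.log q ≠ 0 := (Real.log_pos (by exact_mod_cast hq)).ne'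
  rw [qEntropy, Real.binEntropy, Real.log_inv, Real.log_inv]
  simp only [Real.logb]
  field_simp
  ring

/-- The volume of a Hamming ball of relative radius `δ < 1 - 1 / q` is at most `q ^ (N h_q(δ))`. -/
theorem card_hammingNorm_le {δ : ℝ} (hδ : δ ∈ Set.Ioo (0 : ℝ) (1 - (Fintype.card F : ℝ)⁻¹)) :
    ((Finset.univ.filter fun x : ι → F =>
        (hammingNorm x : ℝ) ≤ δ * Fintype.card ι).card : ℝ) ≤
      (Fintype.card F : ℝ) ^ (Fintype.card ι * qEntropy (Fintype.card F) δ) := by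
  obtain ⟨h0, h1⟩ := hδ
  have hq1 : (1 : ℝ) < Fintype.card F := by exact_mod_cast Fintype.one_lt_card
  set q : ℝ := ((Fintype.card F : ℕ) : ℝ) with hqdef
  set N : ℝ := ((Fintype.card ι : ℕ) : ℝ) with hN
  have hq0 : 0 < q := by linarith
  have hδ1 : 0 < 1 - δ := by
    have : 0 < q⁻¹ := by positivity
    linarith
  set t : ℝ := δ / ((1 - δ) * (q - 1)) with ht
  have hden : 0 < (1 - δ) * (q - 1) := mul_pos hδ1 (by linarith)
  have ht0 : 0 < t := div_pos h0 hden
  have ht1 : t ≤ 1 := by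
    rw [ht, div_le_one hden]
    have : δ * q ≤ q - 1 := by
      have := mul_le_mul_of_nonneg_right h1.le hq0.le
      rwa [sub_mul, inv_mul_cancel₀ hq0.ne', one_mul] at this
    nlinarith
  have hsum := sum_pow_hammingNorm (ι := ι) (F := F) t
  have hcast : ((Fintype.card F - 1 : ℕ) : ℝ) = q - 1 := by
    rw [Nat.cast_sub Fintype.card_pos]; simp [hqdef]
  have hbase : 1 + (q - 1) * t = (1 - δ)⁻¹ := by
    have : q - 1 ≠ 0 := by linarith
    rw [ht]; field_simp; ring
  rw [hcast, hbase] at hsum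
  have hle : ((Finset.univ.filter fun x : ι → F =>
        (hammingNorm x : ℝ) ≤ δ * N).card : ℝ) * t ^ (δ * N) ≤
      ((1 - δ)⁻¹) ^ Fintype.card ι := by
    rw [← hsum, ← nsmul_eq_mul]
    calc _ ≤ ∑ x ∈ Finset.univ.filter (fun x : ι → F => (hammingNorm x : ℝ) ≤ δ * N),
          t ^ hammingNorm x := by
          refine Finset.card_nsmul_le_sum _ _ _ fun x hx => ?_
          rw [← Real.rpow_natCast]
          exact Real.rpow_le_rpow_of_exponent_ge ht0 ht1 (Finset.mem_filter.1 hx).2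
      _ ≤ _ := Finset.sum_le_sum_of_subset_of_nonneg (Finset.filter_subset _ _)
          fun x _ _ => by positivity
  have htp : 0 < t ^ (δ * N) := Real.rpow_pos_of_pos ht0 _
  rw [← le_div_iff₀ htp] at hle
  refine hle.trans_eq ?_
  have hent := qEntropy_mul_log (q := Fintype.card F) Fintype.one_lt_card δ
  rw [← Real.rpow_natCast, Real.rpow_def_of_pos (by positivity), Real.rpow_def_of_pos ht0,
    ← Real.exp_sub, Real.rpow_def_of_pos hq0]
  congr 1
  rw [← hqdef] at hent
  rw [show Real.log q * (N * qEntropy (Fintype.card F) δ) =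
    N * (qEntropy (Fintype.card F) δ * Real.log q) by ring, hent, Real.binEntropy, ht,
    Real.log_div h0.ne' hden.ne', Real.log_mul hδ1.ne' (by linarith), Real.log_inv, Real.log_inv]
  ring

end HammingCounting

/-! ### Entropy lower bound for binomial coefficients. -/

section BinomialEntropy

/-- The terms of the expansion of `(j + l)^(j + l)` increase up to index `j` and decrease
afterwards: consecutive ones have ratio `(j + l - i) j / ((i + 1) l)`. -/
theorem choose_mul_pow_le_of_add {j l i : ℕ} (hi : i ≤ j + l) :
    (j + l).choose i * j ^ i * l ^ (j + l - i) ≤ (j + l).choose j * j ^ j * l ^ l := by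
  have up : ∀ i, i < j → (j + l).choose i * j ^ i * l ^ (j + l - i) ≤
      (j + l).choose (i + 1) * j ^ (i + 1) * l ^ (j + l - (i + 1)) := by
    intro i hij
    have hc := Nat.choose_succ_right_eq (j + l) i
    have key : (j + l).choose i * l ≤ (j + l).choose (i + 1) * j := by
      refine Nat.le_of_mul_le_mul_left ?_ (Nat.succ_pos i)
      calc (i + 1) * ((j + l).choose i * l) ≤ (j + l).choose i * (j + l - i) * j := by
            have : (i + 1) * l ≤ (j + l - i) * j := by
              rw [mul_comm]; exact Nat.mul_le_mul (by omega) (by omega)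
            nlinarith [Nat.mul_le_mul_left ((j + l).choose i) this]
        _ = (i + 1) * ((j + l).choose (i + 1) * j) := by rw [← hc]; ring
    rw [show j + l - i = j + l - (i + 1) + 1 by omega, pow_succ, pow_succ]
    calc _ = (j + l).choose i * l * (j ^ i * l ^ (j + l - (i + 1))) := by ring
      _ ≤ (j + l).choose (i + 1) * j * (j ^ i * l ^ (j + l - (i + 1))) :=
          Nat.mul_le_mul_right _ key
      _ = _ := by ring
  have down : ∀ i, j ≤ i → i < j + l → (j + l).choose (i + 1) * j ^ (i + 1) *
      l ^ (j + l - (i + 1)) ≤ (j + l).choose i * j ^ i * l ^ (j + l - i) := by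
    intro i hij hil
    have hc := Nat.choose_succ_right_eq (j + l) i
    have key : (j + l).choose (i + 1) * j ≤ (j + l).choose i * l := by
      refine Nat.le_of_mul_le_mul_left ?_ (Nat.succ_pos i)
      calc (i + 1) * ((j + l).choose (i + 1) * j) = (j + l).choose i * (j + l - i) * j := by
            rw [← hc]; ring
        _ ≤ (i + 1) * ((j + l).choose i * l) := by
            have : (j + l - i) * j ≤ l * (i + 1) := Nat.mul_le_mul (by omega) (by omega)
            nlinarith [Nat.mul_le_mul_left ((j + l).choose i) this]
    rw [show j + l - i = j + l - (i + 1) + 1 by omega, pow_succ, pow_succ]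
    calc _ = (j + l).choose (i + 1) * j * (j ^ i * l ^ (j + l - (i + 1))) := by ring
      _ ≤ (j + l).choose i * l * (j ^ i * l ^ (j + l - (i + 1))) :=
          Nat.mul_le_mul_right _ key
      _ = _ := by ring
  rcases le_total i j with h | h
  · refine Nat.decreasingInduction' (P := fun i => (j + l).choose i * j ^ i * l ^ (j + l - i) ≤
      (j + l).choose j * j ^ j * l ^ l) (fun k hk _ ih => (up k hk).trans ih) h ?_
    simp
  · induction i, h using Nat.le_induction with
    | base => simp
    | succ k hk ih => exact (down k hk (by omega)).trans (ih (by omega))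

/-- A sum of `n + 1` terms is at most `n + 1` times its largest term. -/
theorem pow_le_succ_mul_choose {n j : ℕ} (hj : j ≤ n) :
    n ^ n ≤ (n + 1) * (n.choose j * j ^ j * (n - j) ^ (n - j)) := by
  obtain ⟨l, rfl⟩ := Nat.exists_eq_add_of_le hj
  rw [add_tsub_cancel_left]
  conv_lhs => rw [add_pow]
  refine (Finset.sum_le_card_nsmul _ _ ((j + l).choose j * j ^ j * l ^ l) fun i hi => ?_).trans ?_
  · refine le_trans (le_of_eq ?_) (choose_mul_pow_le_of_add (i := i) (j := j) (l := l) ?_)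
    · simp only [Nat.cast_id]; ring
    · simpa [Nat.lt_succ_iff] using hi
  · simp

/-- The entropy lower bound for binomial coefficients. -/
theorem mul_binEntropy_le_log_choose {n j : ℕ} (h0 : 0 < j) (hj : j < n) :
    n * Real.binEntropy (j / n) ≤ Real.log (n + 1) + Real.log (n.choose j) := by
  have h := pow_le_succ_mul_choose hj.le
  have hn : (0 : ℝ) < n := by exact_mod_cast h0.trans hj
  have hj0 : (0 : ℝ) < j := by exact_mod_cast h0
  have hl0 : (0 : ℝ) < (n : ℝ) - j := by rw [sub_pos]; exact_mod_cast hj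
  have hc : (0 : ℝ) < n.choose j := by exact_mod_cast Nat.choose_pos hj.le
  have h' : ((n : ℝ)) ^ n ≤ (n + 1) * (n.choose j * (j : ℝ) ^ j * ((n : ℝ) - j) ^ (n - j)) := by
    rw [← Nat.cast_sub hj.le]; exact_mod_cast h
  have hlog := Real.log_le_log (by positivity) h'
  rw [Real.log_mul (by positivity) (by positivity), Real.log_mul (by positivity) (by positivity),
    Real.log_mul (by positivity) (by positivity), Real.log_pow, Real.log_pow, Real.log_pow,
    Nat.cast_sub hj.le] at hlog
  rw [Real.binEntropy, Real.log_inv, Real.log_inv,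
    show (1 : ℝ) - j / n = ((n : ℝ) - j) / n by field_simp,
    Real.log_div hj0.ne' hn.ne', Real.log_div hl0.ne' hn.ne']
  have : (n : ℝ) * (j / n * -(Real.log j - Real.log n) +
      (n - j) / n * -(Real.log (n - j) - Real.log n)) =
      n * Real.log n - j * Real.log j - (n - j) * Real.log (n - j) := by
    field_simp; ring
  rw [this]
  linarith

end BinomialEntropy

/-! ### Uniform images and the second moment method. -/

section Counting

/-- The fibres are cosets of the kernel, so a surjective homomorphism carries the uniform
distribution to the uniform one. -/
theorem ncard_preimage_mul_card {M N : Type*} [AddGroup M] [AddGroup N] [Finite M] [Finite N]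
    (φ : M →+ N) (hφ : Function.Surjective φ) (S : Set N) :
    (φ ⁻¹' S).ncard * Nat.card N = S.ncard * Nat.card M := by
  classical
  have := Fintype.ofFinite M
  have := Fintype.ofFinite N
  have hfib : ∀ y, (Finset.univ.filter fun a => φ a = y).card =
      (Finset.univ.filter fun a => φ a = 0).card := fun y =>
    AddMonoidHom.card_fiber_eq_of_mem_range φ (hφ y) ⟨0, map_zero φ⟩
  have hpre : ∀ S : Set N, (φ ⁻¹' S).ncard =
      S.ncard * (Finset.univ.filter fun a => φ a = 0).card := by
    intro S
    rw [Set.ncard_eq_toFinset_card', Set.ncard_eq_toFinset_card',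
      Finset.card_eq_sum_card_fiberwise (f := φ) (t := S.toFinset) (fun a ha => by simpa using ha),
      ← smul_eq_mul, ← Finset.sum_const]
    refine Finset.sum_congr rfl fun y hy => ?_
    rw [← hfib y]
    congr 1
    ext a
    simp only [Finset.mem_filter, Set.mem_toFinset, Set.mem_preimage, Finset.mem_univ, true_and,
      and_iff_right_iff_imp]
    rintro rfl
    simpa using hy
  have huniv := hpre Set.univ
  rw [Set.preimage_univ, Set.ncard_univ, Set.ncard_univ] at huniv
  rw [hpre, huniv]
  ring

/-- The second moment method for pairwise uncorrelated events of equal probability. -/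
theorem ncard_forall_not_mul_le {Ω β : Type*} [Finite Ω] (B : Finset β) (E : β → Set Ω) {p : ℝ}
    (hp : 0 < p) (h1 : ∀ b ∈ B, ((E b).ncard : ℝ) = p * Nat.card Ω)
    (h2 : ∀ b ∈ B, ∀ b' ∈ B, b ≠ b' → ((E b ∩ E b').ncard : ℝ) ≤ p ^ 2 * Nat.card Ω) :
    ({ω | ∀ b ∈ B, ω ∉ E b}.ncard : ℝ) * (B.card * p) ≤ Nat.card Ω := by
  classical
  have := Fintype.ofFinite Ω
  rcases B.eq_empty_or_nonempty with rfl | hB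
  · simp
  set μ : ℝ := B.card * p with hμ
  have hμ0 : 0 < μ := mul_pos (by exact_mod_cast hB.card_pos) hp
  have hsum : ∀ (S : Set Ω) [DecidablePred (· ∈ S)], ∑ ω, (if ω ∈ S then (1 : ℝ) else 0) = S.ncard := by
    intro S _
    rw [Set.ncard_eq_toFinset_card', Finset.sum_boole]
    congr 2
    ext; simp
  let X : Ω → ℝ := fun ω => ∑ b ∈ B, if ω ∈ E b then (1 : ℝ) else 0
  have hX1 : ∑ ω, X ω = μ * Nat.card Ω := by
    simp only [X]
    rw [Finset.sum_comm]
    simp_rw [hsum]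
    rw [Finset.sum_congr rfl h1, Finset.sum_const, nsmul_eq_mul, hμ]
    ring
  have hX2 : ∑ ω, X ω ^ 2 ≤ μ * Nat.card Ω + μ ^ 2 * Nat.card Ω := by
    have : ∀ ω, X ω ^ 2 = ∑ b ∈ B, ∑ b' ∈ B, if ω ∈ E b ∩ E b' then (1 : ℝ) else 0 := by
      intro ω
      simp only [X]
      rw [sq, Finset.sum_mul_sum]
      refine Finset.sum_congr rfl fun b _ => Finset.sum_congr rfl fun b' _ => ?_
      by_cases h : ω ∈ E b <;> by_cases h' : ω ∈ E b' <;> simp [h, h']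
    simp_rw [this]
    rw [Finset.sum_comm]
    have hb : ∀ b ∈ B, ∑ ω, ∑ b' ∈ B, (if ω ∈ E b ∩ E b' then (1 : ℝ) else 0) ≤
        p * Nat.card Ω + B.card * (p ^ 2 * Nat.card Ω) := by
      intro b hb
      rw [Finset.sum_comm]
      simp_rw [hsum]
      rw [← Finset.add_sum_erase _ _ hb, Set.inter_self, h1 b hb]
      gcongr
      calc _ ≤ ∑ b' ∈ B.erase b, p ^ 2 * (Nat.card Ω : ℝ) := Finset.sum_le_sum fun b' hb' =>
            h2 b hb b' (Finset.mem_of_mem_erase hb') (Finset.ne_of_mem_erase hb').symm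
        _ ≤ ∑ b' ∈ B, p ^ 2 * (Nat.card Ω : ℝ) :=
            Finset.sum_le_sum_of_subset_of_nonneg (Finset.erase_subset _ _)
              fun _ _ _ => by positivity
        _ = _ := by rw [Finset.sum_const, nsmul_eq_mul]
    refine (Finset.sum_le_sum hb).trans_eq ?_
    rw [Finset.sum_const, nsmul_eq_mul, hμ]
    ring
  have hvar : ∑ ω, (X ω - μ) ^ 2 ≤ μ * Nat.card Ω := by
    have : ∑ ω, (X ω - μ) ^ 2 = ∑ ω, X ω ^ 2 - 2 * μ * ∑ ω, X ω + μ ^ 2 * Nat.card Ω := by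
      rw [Finset.mul_sum, ← Finset.sum_sub_distrib, Nat.card_eq_fintype_card,
        ← Finset.card_univ, mul_comm (μ ^ 2), ← nsmul_eq_mul, ← Finset.sum_const,
        ← Finset.sum_add_distrib]
      exact Finset.sum_congr rfl fun ω _ => by ring
    rw [this, hX1]
    linarith
  -- Chebyshev: where no event occurs, `X = 0` and the deviation is exactly `μ`.
  have hbad : ({ω | ∀ b ∈ B, ω ∉ E b}.ncard : ℝ) * μ ^ 2 ≤ ∑ ω, (X ω - μ) ^ 2 := by
    rw [← hsum, Finset.sum_mul]
    refine Finset.sum_le_sum fun ω _ => ?_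
    split_ifs with h
    · have : X ω = 0 := Finset.sum_eq_zero fun b hb => if_neg (h b hb)
      rw [this]; simp
    · rw [zero_mul]; positivity
  refine le_of_mul_le_mul_right ?_ hμ0
  calc _ = ({ω | ∀ b ∈ B, ω ∉ E b}.ncard : ℝ) * μ ^ 2 := by ring
    _ ≤ _ := (hbad.trans hvar).trans_eq (mul_comm _ _)

end Counting

/-! ### Light words over an ideal, and the distribution of `bA`. -/

section UpperBound

open MonoidAlgebra

/-- An information set: a separating family of functionals contains a separating subfamily whose
cardinality is the dimension. -/
theorem exists_card_eq_finrank_separating {K V ι : Type*} [Field K] [AddCommGroup V] [Module K V]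
    [FiniteDimensional K V] [Finite ι] (v : ι → Module.Dual K V)
    (hv : ∀ u, (∀ i, v i u = 0) → u = 0) :
    ∃ J : Finset ι, J.card = Module.finrank K V ∧ ∀ u, (∀ i ∈ J, v i u = 0) → u = 0 := by
  classical
  obtain ⟨κ, a, ha, hspan, hli⟩ := exists_linearIndependent' K v
  have : Finite κ := Finite.of_injective a ha
  have := Fintype.ofFinite κ
  have hsep : ∀ u, (∀ i, v (a i) u = 0) → u = 0 := by
    intro u hu
    refine hv u fun i => ?_
    have hmem : v i ∈ Submodule.span K (Set.range (v ∘ a)) := by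
      rw [hspan]; exact Submodule.subset_span ⟨i, rfl⟩
    generalize v i = w at hmem
    induction hmem using Submodule.span_induction with
    | mem x hx => obtain ⟨j, rfl⟩ := hx; exact hu j
    | zero => rfl
    | add x y _ _ hx hy => rw [LinearMap.add_apply, hx, hy, add_zero]
    | smul c x _ hx => rw [LinearMap.smul_apply, hx, smul_zero]
  refine ⟨Finset.univ.image a, ?_, fun u hu => hsep u fun i => hu _ (by simp)⟩
  rw [Finset.card_image_of_injective _ ha, Finset.card_univ]
  -- Independence in the dual bounds the size above; injectivity of the joint evaluation bounds it
  -- below.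
  refine le_antisymm ?_ ?_
  · rw [← Subspace.dual_finrank_eq (K := K) (V := V)]
    exact hli.fintype_card_le_finrank
  · have hinj : Function.Injective (LinearMap.pi fun i => v (a i)) := by
      rw [injective_iff_map_eq_zero]
      intro u hu
      exact hsep u fun i => congrFun hu i
    simpa using LinearMap.finrank_le_finrank_of_injective hinj

variable {F G : Type*} [Field F] [CommGroup G] [Fintype G]

instance finite_monoidAlgebra [Finite F] : Finite (MonoidAlgebra F G) :=
  Finite.of_equiv (G → F) (coeffEquiv.trans Finsupp.equivFunOnFinite).symm

/-- Each coordinate lies in exactly `|J|` of the windows `zJ`; this is the balancedness used for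
averaging. -/
theorem sum_hammingNorm_translates [DecidableEq F] {n : ℕ} (J : Finset G) (c : Fin n → MonoidAlgebra F G) :
    ∑ z : G, hammingNorm (fun p : Fin n × J => (c p.1).coeff (z * p.2)) =
      J.card * wordWeight c := by
  classical
  simp only [wordWeight, hammingNorm, Finset.card_filter]
  rw [Finset.sum_comm, Fintype.sum_prod_type, Finset.mul_sum]
  refine Finset.sum_congr rfl fun i _ => ?_
  have : ∀ g : J, ∑ z : G, (if (c i).coeff (z * g) ≠ 0 then 1 else 0) =
      ∑ z : G, if (c i).coeff z ≠ 0 then 1 else 0 := fun g =>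
    Fintype.sum_equiv (Equiv.mulRight (g : G)) _ _ fun z => rfl
  simp only [this, Finset.sum_const, smul_eq_mul, Finset.card_univ, Fintype.card_coe]

/-- Words of small weight over an ideal: `I ^ n` is a balanced code, so its number of words of
relative weight at most `δ` is controlled by the entropy. -/
theorem ncard_wordWeight_le [Fintype F] [DecidableEq F] (I : Ideal (MonoidAlgebra F G)) (n : ℕ) {δ : ℝ}
    (hδ : δ ∈ Set.Ioo (0 : ℝ) (1 - (Fintype.card F : ℝ)⁻¹)) :
    ({c : Fin n → I | (wordWeight (fun i => (c i : MonoidAlgebra F G)) : ℝ) ≤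
        δ * (Fintype.card G * n)}.ncard : ℝ) ≤
      Fintype.card G * (Fintype.card F : ℝ) ^
        ((n * Module.finrank F I : ℝ) * qEntropy (Fintype.card F) δ) := by
  classical
  let v : G → Module.Dual F I := fun g =>
    { toFun := fun u => (u : MonoidAlgebra F G).coeff g
      map_add' := fun x y => by simp
      map_smul' := fun a x => by simp }
  have hv : ∀ g u, v g u = (u : MonoidAlgebra F G).coeff g := fun _ _ => rfl
  obtain ⟨J, hJ, hsep⟩ := exists_card_eq_finrank_separating v (fun u hu => by
    apply Subtype.ext
    ext g
    simpa [hv] using hu g)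
  let ψ : G → (Fin n → I) → (Fin n × J → F) := fun z c p =>
    (c p.1 : MonoidAlgebra F G).coeff (z * p.2)
  have hψ : ∀ z, Function.Injective (ψ z) := by
    intro z c c' h
    funext i
    -- Multiplication by `z⁻¹` preserves the ideal and moves the window `zJ` to `J`, so `zJ` is also
    -- an information set.
    have h0 : (single z⁻¹ 1 : MonoidAlgebra F G) • (c i - c' i) = 0 := by
      refine hsep _ fun g hg => ?_
      have := congrFun h (i, ⟨g, hg⟩)
      simp only [ψ] at this
      simp [hv, coeff_single_mul_apply, this]
    have h1 : (single z 1 : MonoidAlgebra F G) • (single z⁻¹ 1 : MonoidAlgebra F G) •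
        (c i - c' i) = 0 := by rw [h0, smul_zero]
    rw [smul_smul, single_mul_single, mul_inv_cancel, mul_one, ← one_def, one_smul] at h1
    exact sub_eq_zero.1 h1
  let Ball : Set (Fin n × J → F) := {x | (hammingNorm x : ℝ) ≤ δ * Fintype.card (Fin n × J)}
  have hcard : (Fintype.card (Fin n × J) : ℝ) = n * Module.finrank F I := by
    simp [hJ]
  have hsub : {c : Fin n → I | (wordWeight (fun i => (c i : MonoidAlgebra F G)) : ℝ) ≤
      δ * (Fintype.card G * n)} ⊆ ⋃ z, ψ z ⁻¹' Ball := by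
    -- If every window had relative weight above `δ`, averaging over `z` would make the whole word
    -- heavier than `δ`.
    intro c hc
    by_contra hcon
    simp only [Set.mem_iUnion, Set.mem_preimage, Ball, Set.mem_ofPred_eq, not_exists,
      not_le] at hcon hc
    have hs := sum_hammingNorm_translates J (fun i => (c i : MonoidAlgebra F G))
    have hlt : ∑ z : G, δ * (Fintype.card (Fin n × J) : ℝ) < ∑ z, (hammingNorm (ψ z c) : ℝ) :=
      Finset.sum_lt_sum_of_nonempty Finset.univ_nonempty fun z _ => hcon z
    have hs' : ∑ z, (hammingNorm (ψ z c) : ℝ) =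
        J.card * wordWeight (fun i => (c i : MonoidAlgebra F G)) := by
      exact_mod_cast hs
    rw [hs', Finset.sum_const, nsmul_eq_mul, Finset.card_univ, hcard, ← hJ] at hlt
    have := mul_le_mul_of_nonneg_left hc (Nat.cast_nonneg (α := ℝ) J.card)
    linarith
  have hball : (Ball.ncard : ℝ) ≤ (Fintype.card F : ℝ) ^
      ((n * Module.finrank F I : ℝ) * qEntropy (Fintype.card F) δ) := by
    rw [← hcard]
    refine le_trans (le_of_eq ?_) (card_hammingNorm_le hδ)
    rw [Set.ncard_eq_toFinset_card']
    congr 2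
    ext; simp [Ball]
  calc _ ≤ ((∑ z : G, (ψ z ⁻¹' Ball).ncard : ℕ) : ℝ) := by
        exact_mod_cast (Set.ncard_le_ncard hsub).trans (Set.ncard_iUnion_le_of_fintype _)
    _ ≤ ∑ z : G, (Ball.ncard : ℝ) := by
        rw [Nat.cast_sum]
        refine Finset.sum_le_sum fun z _ => ?_
        exact_mod_cast Set.ncard_le_ncard_of_injOn (ψ z) (fun _ h => h) (hψ z).injOn
    _ = Fintype.card G * Ball.ncard := by simp
    _ ≤ _ := by gcongr

theorem card_ideal_pow [Fintype F] (I : Ideal (MonoidAlgebra F G)) (k : ℕ) :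
    (Nat.card (Fin k → I) : ℝ) = (Fintype.card F : ℝ) ^ (k * Module.finrank F I : ℝ) := by
  rw [Nat.card_fun, Module.natCard_eq_pow_finrank (K := F) (V := I)]
  simp only [Nat.card_eq_fintype_card, Fintype.card_fin]
  rw [← Nat.cast_mul, Real.rpow_natCast, ← pow_mul]
  push_cast
  rw [mul_comm]

/-- For fixed `b` generating the ideal `I`, the word `b A` is uniformly distributed on `I ^ n`. -/
theorem ncard_vecMul_wordWeight_le [Fintype F] [DecidableEq F] {k n : ℕ} (b : Fin k → MonoidAlgebra F G) {δ : ℝ}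
    (hδ : δ ∈ Set.Ioo (0 : ℝ) (1 - (Fintype.card F : ℝ)⁻¹)) :
    ({A : Matrix (Fin k) (Fin n) (MonoidAlgebra F G) |
        (wordWeight (Matrix.vecMul b A) : ℝ) ≤ δ * (Fintype.card G * n)}.ncard : ℝ) ≤
      Nat.card (Matrix (Fin k) (Fin n) (MonoidAlgebra F G)) *
        (Fintype.card G * (Fintype.card F : ℝ) ^
          (-(n * Module.finrank F (Ideal.span (Set.range b)) * gvBound (Fintype.card F) δ))) := by
  set I := Ideal.span (Set.range b) with hI
  have hmem : ∀ (A : Matrix (Fin k) (Fin n) (MonoidAlgebra F G)) j, Matrix.vecMul b A j ∈ I := by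
    intro A j
    change ∑ i, b i * A i j ∈ I
    refine Ideal.sum_mem _ fun i _ => Ideal.mul_mem_right _ _ (Ideal.subset_span (Set.mem_range_self i))
  let φ : Matrix (Fin k) (Fin n) (MonoidAlgebra F G) →+ (Fin n → I) :=
    { toFun := fun A => (fun j => ⟨Matrix.vecMul b A j, hmem A j⟩ : Fin n → I)
      map_zero' := by funext j; apply Subtype.ext; simp
      map_add' := fun A A' => by
        funext j; apply Subtype.ext; simp [Matrix.vecMul_add] }
  have hφ : Function.Surjective φ := by
    intro y
    have : ∀ j, ∃ a : Fin k → MonoidAlgebra F G, ∑ i, a i * b i = y j := fun j =>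
      Ideal.mem_span_range_iff_exists_fun.1 (y j).2
    choose a ha using this
    refine ⟨Matrix.of fun i j => a j i, ?_⟩
    funext j
    apply Subtype.ext
    change Matrix.vecMul b _ j = _
    rw [← ha j]
    simp [Matrix.vecMul, dotProduct, mul_comm]
  have hcount := ncard_preimage_mul_card φ hφ
    {c | (wordWeight (fun i => (c i : MonoidAlgebra F G)) : ℝ) ≤ δ * (Fintype.card G * n)}
  have hcount' := congrArg (Nat.cast (R := ℝ)) hcount
  push_cast at hcount'
  have hq : (0 : ℝ) < Fintype.card F := by exact_mod_cast Fintype.card_pos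
  rw [card_ideal_pow, ← eq_div_iff (by positivity)] at hcount'
  refine hcount'.le.trans ?_
  rw [mul_comm, mul_div_assoc]
  gcongr
  rw [div_le_iff₀ (by positivity), mul_assoc, ← Real.rpow_add hq]
  refine (ncard_wordWeight_le I n hδ).trans_eq ?_
  congr 2
  rw [gvBound]
  ring

end UpperBound

/-! ### Union bound below the threshold. -/

section FirstMoment

variable {F G : Type*} [Field F] [DecidableEq F] [CommGroup G] [Fintype G]

theorem exists_wordWeight_le_of_not_lt_relativeDistance {k n : ℕ} (hn : 1 ≤ n) {δ : ℝ}
    (hδ : 0 ≤ δ) (A : Matrix (Fin k) (Fin n) (MonoidAlgebra F G))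
    (hA : ¬ ENNReal.ofReal δ < relativeDistance (quasiAbelianCode A)) :
    ∃ b, Matrix.vecMul b A ≠ 0 ∧
      (wordWeight (Matrix.vecMul b A) : ℝ) ≤ δ * (Fintype.card G * n) := by
  by_contra! hcon
  refine hA ?_
  have hpos : (0 : ℝ) ≤ δ * (Fintype.card G * n) := by positivity
  -- Integrality keeps the inequality strict when passing to the infimum; the zero code, with
  -- infimum `⊤`, is included.
  have hmin : ((⌊δ * (Fintype.card G * n)⌋₊ + 1 : ℕ) : ℕ∞) ≤ minWeight (quasiAbelianCode A) := by
    refine le_iInf₂ fun c hc => ?_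
    obtain ⟨⟨b, rfl⟩, hne⟩ := hc
    exact_mod_cast (Nat.floor_lt hpos).2 (hcon b hne)
  have hmin' : ((⌊δ * (Fintype.card G * n)⌋₊ + 1 : ℕ) : ℝ≥0∞) ≤
      (minWeight (quasiAbelianCode A) : ℝ≥0∞) := by
    have := ENat.toENNReal_le.2 hmin
    rwa [ENat.toENNReal_coe] at this
  have hmn : 0 < Fintype.card G * n := Nat.mul_pos Fintype.card_pos hn
  refine lt_of_lt_of_le ?_ (ENNReal.div_le_div_right hmin' _)
  rw [ENNReal.lt_div_iff_mul_lt (Or.inl (by exact_mod_cast hmn.ne'))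
    (Or.inl (ENNReal.natCast_ne_top _)), ← ENNReal.ofReal_natCast (Fintype.card G * n),
    ← ENNReal.ofReal_mul hδ, ← ENNReal.ofReal_natCast (_ + 1),
    ENNReal.ofReal_lt_ofReal_iff (by positivity)]
  push_cast
  exact Nat.lt_floor_add_one _

theorem probRelativeDistanceGT_nonneg (k n : ℕ) (δ : ℝ) :
    0 ≤ probRelativeDistanceGT F G k n δ := by
  rw [probRelativeDistanceGT]; positivity

variable [Fintype F]

theorem one_sub_probRelativeDistanceGT (k n : ℕ) (δ : ℝ) :
    1 - probRelativeDistanceGT F G k n δ =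
      ({A : Matrix (Fin k) (Fin n) (MonoidAlgebra F G) |
        ¬ ENNReal.ofReal δ < relativeDistance (quasiAbelianCode A)}.ncard : ℝ) /
      (Nat.card (Matrix (Fin k) (Fin n) (MonoidAlgebra F G)) : ℝ) := by
  have : Finite (Matrix (Fin k) (Fin n) (MonoidAlgebra F G)) :=
    inferInstanceAs (Finite (Fin k → Fin n → MonoidAlgebra F G))
  have h := Set.ncard_add_ncard_compl {A : Matrix (Fin k) (Fin n) (MonoidAlgebra F G) |
        ENNReal.ofReal δ < relativeDistance (quasiAbelianCode A)}
  have hpos : (0 : ℝ) < Nat.card (Matrix (Fin k) (Fin n) (MonoidAlgebra F G)) := by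
    exact_mod_cast Nat.card_pos
  rw [probRelativeDistanceGT, eq_div_iff hpos.ne', sub_mul, div_mul_cancel₀ _ hpos.ne', one_mul,
    ← h]
  push_cast
  rw [add_sub_cancel_left]
  rfl

theorem probRelativeDistanceGT_le_one (k n : ℕ) (δ : ℝ) :
    probRelativeDistanceGT F G k n δ ≤ 1 := by
  have : 0 ≤ 1 - probRelativeDistanceGT F G k n δ := by
    rw [one_sub_probRelativeDistanceGT]; positivity
  linarith

instance finite_ideal {R : Type*} [Semiring R] [Finite R] : Finite (Ideal R) :=
  Finite.of_injective (fun I => (I : Set R)) SetLike.coe_injective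

/-- The union bound over `b`, grouped by the ideal that the entries of `b` generate. -/
theorem one_sub_probRelativeDistanceGT_le {k n : ℕ} (hn : 1 ≤ n) {r δ : ℝ}
    (hδ : δ ∈ Set.Ioo (0 : ℝ) (1 - (Fintype.card F : ℝ)⁻¹))
    (hk : (k : ℝ) ≤ r * n + 1 / 2) (hr : r < gvBound (Fintype.card F) δ) :
    1 - probRelativeDistanceGT F G k n δ ≤
      Nat.card (Ideal (MonoidAlgebra F G)) * (Fintype.card G * (Fintype.card F : ℝ) ^
        (Fintype.card G / 2 - (gvBound (Fintype.card F) δ - r) * n : ℝ)) := by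
  classical
  have : Finite (Matrix (Fin k) (Fin n) (MonoidAlgebra F G)) :=
    inferInstanceAs (Finite (Fin k → Fin n → MonoidAlgebra F G))
  have := Fintype.ofFinite (MonoidAlgebra F G)
  have := Fintype.ofFinite (Ideal (MonoidAlgebra F G))
  set g := gvBound (Fintype.card F) δ with hg
  set q : ℝ := ((Fintype.card F : ℕ) : ℝ) with hqdef
  have hq1 : 1 < q := by rw [hqdef]; exact_mod_cast Fintype.one_lt_card
  set M : ℝ := ((Nat.card (Matrix (Fin k) (Fin n) (MonoidAlgebra F G)) : ℕ) : ℝ) with hM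
  have hMpos : 0 < M := by rw [hM]; exact_mod_cast Nat.card_pos
  let S : (Fin k → MonoidAlgebra F G) → Ideal (MonoidAlgebra F G) :=
    fun b => Ideal.span (Set.range b)
  let U : (Fin k → MonoidAlgebra F G) → Set (Matrix (Fin k) (Fin n) (MonoidAlgebra F G)) :=
    fun b => {A | (wordWeight (Matrix.vecMul b A) : ℝ) ≤ δ * (Fintype.card G * n)}
  -- The zero ideal comes only from `b = 0`, which yields no nonzero codeword; the value 0 there
  -- lets later sums run over all `b` and all ideals.
  let f : Ideal (MonoidAlgebra F G) → ℝ := fun I =>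
    if I = ⊥ then 0 else Fintype.card G * q ^ (-(n * Module.finrank F I * g))
  have hf0 : ∀ I, 0 ≤ f I := fun I => by
    simp only [f]; split_ifs <;> positivity
  have hsub : {A : Matrix (Fin k) (Fin n) (MonoidAlgebra F G) |
      ¬ ENNReal.ofReal δ < relativeDistance (quasiAbelianCode A)} ⊆
      ⋃ b ∈ Finset.univ.filter (fun b => S b ≠ ⊥), U b := by
    intro A hA
    obtain ⟨b, hne, hw⟩ := exists_wordWeight_le_of_not_lt_relativeDistance hn hδ.1.le A hA
    simp only [Set.mem_iUnion]
    refine ⟨b, Finset.mem_filter.2 ⟨Finset.mem_univ _, fun hb => hne ?_⟩, hw⟩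
    have : b = 0 := by
      funext i
      exact Ideal.span_eq_bot.1 hb _ (Set.mem_range_self i)
    rw [this, Matrix.zero_vecMul]
  have hU : ∀ b ∈ Finset.univ.filter (fun b => S b ≠ ⊥), ((U b).ncard : ℝ) ≤ M * f (S b) := by
    intro b hb
    have := ncard_vecMul_wordWeight_le (n := n) b hδ
    simp only [f, if_neg (Finset.mem_filter.1 hb).2]
    exact this
  have hgroup : ∑ b, f (S b) ≤ ∑ I : Ideal (MonoidAlgebra F G), q ^ (k * Module.finrank F I : ℝ) * f I := by
    rw [← Finset.sum_fiberwise Finset.univ S]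
    refine Finset.sum_le_sum fun I _ => ?_
    rw [Finset.sum_congr rfl (g := fun _ => f I) fun b hb => by rw [(Finset.mem_filter.1 hb).2],
      Finset.sum_const, nsmul_eq_mul]
    refine mul_le_mul_of_nonneg_right ?_ (hf0 I)
    rw [← card_ideal_pow, Nat.card_eq_fintype_card, ← Finset.card_univ]
    refine Nat.cast_le.2 (Finset.card_le_card_of_injOn
      -- The default 0 is never reached: the entries of `b` lie in the ideal they generate.
      (fun b i => if h : b i ∈ I then (⟨b i, h⟩ : I) else 0) (fun _ _ => Finset.mem_univ _) ?_)
    intro b hb b' hb' h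
    have hm : ∀ b ∈ Finset.univ.filter (fun b => S b = I), ∀ i, b i ∈ I := fun b hb i => by
      rw [← (Finset.mem_filter.1 hb).2]; exact Ideal.subset_span (Set.mem_range_self i)
    funext i
    have := congrFun h i
    simp only [dif_pos (hm b hb i), dif_pos (hm b' hb' i)] at this
    exact congrArg Subtype.val this
  have hterm : ∀ I : Ideal (MonoidAlgebra F G), q ^ (k * Module.finrank F I : ℝ) * f I ≤
      Fintype.card G * q ^ (Fintype.card G / 2 - (g - r) * n : ℝ) := by
    intro I
    simp only [f]
    split_ifs with hI
    · rw [mul_zero]; positivity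
    · rw [mul_left_comm, ← Real.rpow_add (by linarith)]
      refine mul_le_mul_of_nonneg_left ?_ (by positivity)
      refine Real.rpow_le_rpow_of_exponent_le hq1.le ?_
      have hd1 : (1 : ℝ) ≤ Module.finrank F I := by
        have : Nontrivial I := Submodule.nontrivial_iff_ne_bot.2 hI
        exact_mod_cast Module.finrank_pos (R := F) (M := I)
      have hdm : (Module.finrank F I : ℝ) ≤ Fintype.card G := by
        have h1 : Module.finrank F I ≤ Module.finrank F (MonoidAlgebra F G) :=
          Submodule.finrank_le (I.restrictScalars F)
        have h2 : Module.finrank F (MonoidAlgebra F G) = Fintype.card G := by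
          rw [(MonoidAlgebra.coeffLinearEquiv (M := G) (S := F) F).finrank_eq]; simp
        exact_mod_cast h1.trans_eq h2
      have hn0 : 0 ≤ (g - r) * (n : ℝ) := mul_nonneg (by linarith) (by positivity)
      -- With `d` the dimension of `I`, the rounding term `d / 2` is bounded using `d ≤ m`, and the
      -- gain `d (g - r) n` using `d ≥ 1`.
      have h3 : (Module.finrank F I : ℝ) * (k - n * g) ≤
          Module.finrank F I * (1 / 2 - (g - r) * n) :=
        mul_le_mul_of_nonneg_left (by linarith) (by positivity)
      have h4 := mul_le_mul_of_nonneg_right hd1 hn0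
      linarith
  rw [one_sub_probRelativeDistanceGT, ← hM, div_le_iff₀ hMpos]
  calc _ ≤ ((∑ b ∈ Finset.univ.filter (fun b => S b ≠ ⊥), (U b).ncard : ℕ) : ℝ) := by
        exact_mod_cast (Set.ncard_le_ncard hsub).trans (Finset.set_ncard_biUnion_le _ _)
    _ ≤ ∑ b ∈ Finset.univ.filter (fun b => S b ≠ ⊥), M * f (S b) := by
        rw [Nat.cast_sum]; exact Finset.sum_le_sum hU
    _ ≤ ∑ b, M * f (S b) := Finset.sum_le_sum_of_subset_of_nonneg (Finset.filter_subset _ _)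
        fun b _ _ => mul_nonneg hMpos.le (hf0 _)
    _ = M * ∑ b, f (S b) := by rw [Finset.mul_sum]
    _ ≤ M * ∑ _I : Ideal (MonoidAlgebra F G),
          Fintype.card G * q ^ (Fintype.card G / 2 - (g - r) * n : ℝ) := by
        gcongr
        exact hgroup.trans (Finset.sum_le_sum fun I _ => hterm I)
    _ = _ := by
        rw [Finset.sum_const, nsmul_eq_mul, Finset.card_univ, ← Nat.card_eq_fintype_card]; ring

theorem ConvergesExponentially.tendsto {a : ℕ → ℝ} {L : ℝ} (h : ConvergesExponentially a L) :
    Tendsto a atTop (𝓝 L) := by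
  obtain ⟨C, c, hc, hb⟩ := h
  rw [tendsto_iff_dist_tendsto_zero]
  refine squeeze_zero' (Eventually.of_forall fun _ => dist_nonneg)
    ((eventually_ge_atTop 1).mono fun n hn => (Real.dist_eq _ _).trans_le (hb n hn)) ?_
  rw [← mul_zero C]
  refine Tendsto.const_mul C (Real.tendsto_exp_atBot.comp ?_)
  exact tendsto_natCast_atTop_atTop.const_mul_atTop_of_neg (by linarith)

theorem convergesExponentially_one {r δ : ℝ}
    (hδ : δ ∈ Set.Ioo (0 : ℝ) (1 - (Fintype.card F : ℝ)⁻¹))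
    {k : ℕ → ℕ} (hk : ∀ n : ℕ, |(k n : ℝ) - r * n| ≤ 1 / 2)
    (hr : r < gvBound (Fintype.card F) δ) :
    ConvergesExponentially (fun n : ℕ => probRelativeDistanceGT F G (k n) n δ) 1 := by
  have hq : (1 : ℝ) < Fintype.card F := by exact_mod_cast Fintype.one_lt_card
  refine ⟨Nat.card (Ideal (MonoidAlgebra F G)) * (Fintype.card G *
    (Fintype.card F : ℝ) ^ (Fintype.card G / 2 : ℝ)),
    (gvBound (Fintype.card F) δ - r) * Real.log (Fintype.card F),
    mul_pos (by linarith) (Real.log_pos hq), fun n hn => ?_⟩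
  have h := one_sub_probRelativeDistanceGT_le (G := G) (k := k n) hn hδ
    (by linarith [(abs_le.1 (hk n)).2]) hr
  have hle := probRelativeDistanceGT_le_one (F := F) (G := G) (k n) n δ
  rw [abs_sub_comm, abs_of_nonneg (sub_nonneg.2 hle)]
  refine h.trans_eq ?_
  rw [Real.rpow_sub (by linarith), Real.rpow_def_of_pos (by linarith : (0:ℝ) < Fintype.card F)
    ((gvBound (Fintype.card F) δ - r) * n), div_eq_mul_inv, ← Real.exp_neg]
  rw [show -((gvBound (Fintype.card F) δ - r) * Real.log (Fintype.card F)) * (n : ℝ) =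
    -(Real.log (Fintype.card F) * ((gvBound (Fintype.card F) δ - r) * n)) by ring]
  ring

end FirstMoment

/-! ### Augmentation and the second moment above the threshold. -/

noncomputable section

section SecondMoment

open MonoidAlgebra

variable {F G : Type*} [Field F] [Fintype G]

variable (F G) in
/-- The augmentation `∑ a_g g ↦ ∑ a_g` of the group algebra, as a linear map. -/
def augmentation : MonoidAlgebra F G →ₗ[F] F where
  toFun a := ∑ g, a.coeff g
  map_add' a b := by simp [Finset.sum_add_distrib]
  map_smul' c a := by simp [Finset.mul_sum]

theorem augmentation_single (g : G) (x : F) : augmentation F G (single g x) = x := by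
  classical
  change ∑ h, (single g x).coeff h = x
  simp [Finsupp.single_apply]

/-- The additive map sending a matrix `A` over `FG` to the codeword `β ε(A)` over `F`. -/
def augmentedVecMul {k n : ℕ} (β : Fin k → F) :
    Matrix (Fin k) (Fin n) (MonoidAlgebra F G) →+ (Fin n → F) where
  toFun A j := ∑ i, β i * augmentation F G (A i j)
  map_zero' := by funext j; simp
  map_add' A A' := by funext j; simp [mul_add, Finset.sum_add_distrib]

theorem augmentedVecMul_apply {k n : ℕ} (β : Fin k → F)
    (A : Matrix (Fin k) (Fin n) (MonoidAlgebra F G)) (j : Fin n) :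
    augmentedVecMul β A j = ∑ i, β i * augmentation F G (A i j) := rfl

variable [CommGroup G]

/-- Multiplication by a multiple of `∑ g` maps onto the repetition code. -/
theorem coeff_smul_sum_single_mul (c : F) (a : MonoidAlgebra F G) (g : G) :
    ((c • ∑ h : G, (single h 1 : MonoidAlgebra F G)) * a).coeff g = c * augmentation F G a := by
  rw [smul_mul_assoc, coeff_smul_apply, smul_eq_mul, Finset.sum_mul, coeff_sum,
    Finsupp.finsetSum_apply]
  congr 1
  simp only [coeff_single_mul_apply, one_mul]
  exact Fintype.sum_equiv ((Equiv.inv G).trans (Equiv.mulRight g)) _ _ fun h => rfl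

/-- Taking `b i = β i • ∑ g` makes `bA` the `m`-fold repetition of `β ε(A)`, which has the same
relative weight. -/
theorem relativeDistance_le_of_augmentation [DecidableEq F] {k n : ℕ} {δ : ℝ} (hδ : 0 ≤ δ)
    (A : Matrix (Fin k) (Fin n) (MonoidAlgebra F G)) (β : Fin k → F)
    (h0 : hammingNorm (fun j => ∑ i, β i * augmentation F G (A i j)) ≠ 0)
    (h1 : (hammingNorm (fun j => ∑ i, β i * augmentation F G (A i j)) : ℝ) ≤ δ * n) :
    relativeDistance (quasiAbelianCode A) ≤ ENNReal.ofReal δ := by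
  set x : Fin n → F := fun j => ∑ i, β i * augmentation F G (A i j) with hx
  let b : Fin k → MonoidAlgebra F G := fun i => β i • ∑ h : G, (single h 1 : MonoidAlgebra F G)
  have hcoeff : ∀ j g, (Matrix.vecMul b A j).coeff g = x j := by
    intro j g
    change (∑ i, b i * A i j).coeff g = _
    rw [coeff_sum, Finsupp.finsetSum_apply]
    exact Finset.sum_congr rfl fun i _ => coeff_smul_sum_single_mul _ _ _
  have hw : wordWeight (Matrix.vecMul b A) = Fintype.card G * hammingNorm x := by
    simp only [wordWeight, hcoeff, hammingNorm, Finset.card_filter]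
    rw [Finset.sum_comm]
    simp
  have hne : Matrix.vecMul b A ≠ 0 := by
    intro h
    refine h0 (hammingNorm_eq_zero.2 ?_)
    funext j
    rw [← hcoeff j 1, h]
    simp
  have hmin : minWeight (quasiAbelianCode A) ≤ ((Fintype.card G * hammingNorm x : ℕ) : ℕ∞) := by
    rw [← hw]
    exact iInf₂_le (Matrix.vecMul b A) ⟨⟨b, rfl⟩, hne⟩
  have hmin' := ENat.toENNReal_le.2 hmin
  rw [ENat.toENNReal_coe] at hmin'
  rw [relativeDistance]
  refine ENNReal.div_le_of_le_mul (hmin'.trans ?_)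
  rw [← ENNReal.ofReal_natCast (Fintype.card G * n), ← ENNReal.ofReal_mul hδ,
    ← ENNReal.ofReal_natCast]
  refine ENNReal.ofReal_le_ofReal ?_
  push_cast
  have := mul_le_mul_of_nonneg_left h1 (Nat.cast_nonneg (α := ℝ) (Fintype.card G))
  linarith

theorem augmentedVecMul_surjective {k n : ℕ} {β : Fin k → F} {i₀ : Fin k} (h : β i₀ = 1) :
    Function.Surjective (augmentedVecMul (G := G) (n := n) β) := by
  intro y
  refine ⟨Matrix.of fun i j => if i = i₀ then single 1 (y j) else 0, ?_⟩
  funext j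
  rw [augmentedVecMul_apply, Finset.sum_eq_single i₀]
  · simp [h, augmentation_single]
  · intro i _ hi; simp [hi]
  · simp

/-- This is pairwise independence: distinct vectors with a common coordinate 1 are linearly
independent. -/
theorem augmentedVecMul_prod_surjective {k n : ℕ} {β β' : Fin k → F} {i₀ : Fin k} (h : β i₀ = 1)
    (h' : β' i₀ = 1) (hne : β ≠ β') :
    Function.Surjective ((augmentedVecMul (G := G) (n := n) β).prod (augmentedVecMul β')) := by
  rintro ⟨y, y'⟩
  obtain ⟨i₁, hi₁⟩ := Function.ne_iff.1 hne
  have hi : i₁ ≠ i₀ := by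
    rintro rfl
    exact hi₁ (h.trans h'.symm)
  have hsub : β i₁ - β' i₁ ≠ 0 := sub_ne_zero.2 hi₁
  -- With only rows `i₀` and `i₁` nonzero, of augmentations `u` and `v`, the system is `u + β i₁ v =
  -- y`, `u + β' i₁ v = y'`.
  let v : Fin n → F := fun j => (β i₁ - β' i₁)⁻¹ * (y j - y' j)
  let A : Matrix (Fin k) (Fin n) (MonoidAlgebra F G) := Matrix.of fun i j =>
    if i = i₀ then single 1 (y j - β i₁ * v j) else if i = i₁ then single 1 (v j) else 0
  have hA : ∀ γ : Fin k → F, γ i₀ = 1 → ∀ j,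
      augmentedVecMul γ A j = y j - β i₁ * v j + γ i₁ * v j := by
    intro γ hγ j
    rw [augmentedVecMul_apply, Finset.sum_eq_add i₀ i₁ hi.symm]
    · simp [A, hγ, hi, augmentation_single]
    · intro i _ hh; simp [A, hh.1, hh.2]
    · simp
    · simp
  refine ⟨A, Prod.ext (funext fun j => ?_) (funext fun j => ?_)⟩
  · change augmentedVecMul β A j = y j
    rw [hA β h]; ring
  · change augmentedVecMul β' A j = y' j
    have : (β i₁ - β' i₁) * v j = y j - y' j := mul_inv_cancel_left₀ hsub _
    rw [hA β' h']
    linear_combination -this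

theorem card_filter_eval_eq_one [Fintype F] [DecidableEq F] {k : ℕ} (i₀ : Fin k) :
    (Finset.univ.filter fun β : Fin k → F => β i₀ = 1).card * Fintype.card F =
      Fintype.card F ^ k := by
  classical
  have h := ncard_preimage_mul_card (Pi.evalAddMonoidHom (fun _ : Fin k => F) i₀)
    (fun y => ⟨fun _ => y, rfl⟩) {1}
  rw [Set.ncard_singleton, one_mul, Set.ncard_eq_toFinset_card', Nat.card_eq_fintype_card,
    Nat.card_eq_fintype_card, Fintype.card_fun, Fintype.card_fin] at h
  rw [← h]
  congr 2
  ext; simp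

/-- Second moment bound with denominators cleared. Normalising a coordinate leaves `q^(k-1)`
vectors, hence the exponent `n + 1`. -/
theorem probRelativeDistanceGT_mul_le [Fintype F] [DecidableEq F] {k n w : ℕ} (hk : 0 < k) (hw0 : 0 < w)
    (hwn : w ≤ n) {δ : ℝ} (hδ : 0 ≤ δ) (hw : (w : ℝ) ≤ δ * n) :
    probRelativeDistanceGT F G k n δ *
      ((Fintype.card F : ℝ) ^ k * (n.choose w * ((Fintype.card F : ℝ) - 1) ^ w)) ≤
      (Fintype.card F : ℝ) ^ (n + 1) := by
  classical
  have : Finite (Matrix (Fin k) (Fin n) (MonoidAlgebra F G)) :=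
    inferInstanceAs (Finite (Fin k → Fin n → MonoidAlgebra F G))
  let i₀ : Fin k := ⟨0, hk⟩
  set q : ℝ := ((Fintype.card F : ℕ) : ℝ) with hqdef
  have hq1 : 1 < q := by rw [hqdef]; exact_mod_cast Fintype.one_lt_card
  set M : ℝ := ((Nat.card (Matrix (Fin k) (Fin n) (MonoidAlgebra F G)) : ℕ) : ℝ) with hM
  have hMpos : 0 < M := by rw [hM]; exact_mod_cast Nat.card_pos
  let B := Finset.univ.filter fun β : Fin k → F => β i₀ = 1
  let T : Set (Fin n → F) := {x | hammingNorm x = w}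
  let E : (Fin k → F) → Set (Matrix (Fin k) (Fin n) (MonoidAlgebra F G)) :=
    fun β => augmentedVecMul β ⁻¹' T
  have hT : (T.ncard : ℝ) = n.choose w * (q - 1) ^ w := by
    have h := card_hammingNorm_eq (ι := Fin n) (F := F) w
    rw [Set.ncard_eq_toFinset_card', show T.toFinset =
      Finset.univ.filter fun x : Fin n → F => hammingNorm x = w by ext; simp [T], h,
      Fintype.card_fin]
    push_cast [Nat.cast_sub (Fintype.card_pos (α := F))]
    simp [hqdef]
  have hTpos : (0 : ℝ) < T.ncard := by
    rw [hT]
    have : (0 : ℝ) < n.choose w := by exact_mod_cast Nat.choose_pos hwn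
    have : 0 < q - 1 := by linarith
    positivity
  have hN : ((Nat.card (Fin n → F) : ℕ) : ℝ) = q ^ n := by
    rw [Nat.card_eq_fintype_card, Fintype.card_fun, Fintype.card_fin]; push_cast; rfl
  have hqn : 0 < q ^ n := by positivity
  have hB : (B.card : ℝ) * q = q ^ k := by
    rw [hqdef, ← Nat.cast_mul, card_filter_eval_eq_one (F := F) i₀, Nat.cast_pow]
  have h2 := ncard_forall_not_mul_le B E (p := T.ncard / q ^ n) (by positivity)
    (fun β hβ => by
      have h := congrArg (Nat.cast (R := ℝ)) (ncard_preimage_mul_card _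
        (augmentedVecMul_surjective (G := G) (n := n) (Finset.mem_filter.1 hβ).2) T)
      push_cast at h
      rw [hN, ← hM] at h
      rw [← hM, div_mul_eq_mul_div, eq_div_iff hqn.ne']
      exact h)
    (fun β hβ β' hβ' hne => by
      have h := congrArg (Nat.cast (R := ℝ)) (ncard_preimage_mul_card _
        (augmentedVecMul_prod_surjective (G := G) (n := n) (Finset.mem_filter.1 hβ).2
          (Finset.mem_filter.1 hβ').2 hne) (T ×ˢ T))
      rw [Nat.card_prod, Set.ncard_prod] at h
      push_cast at h
      rw [hN, ← hM] at h
      rw [← hM, div_pow, div_mul_eq_mul_div, le_div_iff₀ (by positivity), sq, sq]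
      exact h.le)
  have hsub : {A : Matrix (Fin k) (Fin n) (MonoidAlgebra F G) |
      ENNReal.ofReal δ < relativeDistance (quasiAbelianCode A)} ⊆ {A | ∀ β ∈ B, A ∉ E β} := by
    intro A hA β _ hE
    have hE' : hammingNorm (fun j => ∑ i, β i * augmentation F G (A i j)) = w := hE
    exact absurd hA (not_lt.2 (relativeDistance_le_of_augmentation hδ A β
      (by rw [hE']; exact hw0.ne') (by rw [hE']; exact hw)))
  have hle : probRelativeDistanceGT F G k n δ * M ≤ ({A | ∀ β ∈ B, A ∉ E β}.ncard : ℝ) := by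
    rw [probRelativeDistanceGT, ← hM, div_mul_cancel₀ _ hMpos.ne']
    exact_mod_cast Set.ncard_le_ncard hsub
  have h3 : probRelativeDistanceGT F G k n δ * M * (B.card * (T.ncard / q ^ n)) ≤ M :=
    (mul_le_mul_of_nonneg_right hle (by positivity)).trans h2
  have h4 : probRelativeDistanceGT F G k n δ * (B.card * (T.ncard / q ^ n)) ≤ 1 := by
    refine le_of_mul_le_mul_left ?_ hMpos
    linarith
  rw [← mul_div_assoc, ← mul_div_assoc, div_le_one hqn] at h4
  rw [← hT, ← hB, pow_succ]
  have := mul_le_mul_of_nonneg_right h4 (by linarith : 0 ≤ q)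
  linarith

end SecondMoment

end

/-! ### Asymptotics above the threshold. -/

section Threshold

variable {F G : Type*} [Field F] [Fintype F] [DecidableEq F] [CommGroup G] [Fintype G]

theorem eventually_log_succ_add_le {ε : ℝ} (hε : 0 < ε) (c : ℝ) :
    ∀ᶠ n : ℕ in atTop, Real.log (n + 1) + c ≤ ε * n := by
  have h1 : ∀ᶠ x : ℝ in atTop, ‖Real.log x‖ ≤ ε / 2 * ‖x‖ :=
    Real.isLittleO_log_id_atTop.bound (half_pos hε)
  have h2 : Tendsto (fun n : ℕ => (n : ℝ) + 1) atTop atTop :=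
    tendsto_atTop_add_const_right _ _ tendsto_natCast_atTop_atTop
  filter_upwards [h2.eventually h1,
    tendsto_natCast_atTop_atTop.eventually_ge_atTop (1 + 2 * c / ε)] with n hn hc
  rw [Real.norm_of_nonneg (by positivity : (0 : ℝ) ≤ n + 1)] at hn
  have h3 := (le_abs_self _).trans hn
  have h4 := mul_le_mul_of_nonneg_left hc hε.le
  have h5 : ε * (1 + 2 * c / ε) = ε + 2 * c := by field_simp
  linarith

theorem eventually_probRelativeDistanceGT_le {r δ : ℝ} (hr : 0 < r)
    (hδ : δ ∈ Set.Ioo (0 : ℝ) 1) {k : ℕ → ℕ} (hk : ∀ n : ℕ, |(k n : ℝ) - r * n| ≤ 1 / 2)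
    (hg : gvBound (Fintype.card F) δ < r) :
    ∃ c : ℝ, 0 < c ∧ ∀ᶠ n : ℕ in atTop,
      probRelativeDistanceGT F G (k n) n δ ≤ Real.exp (-c * n) := by
  have hq1 : (1 : ℝ) < Fintype.card F := by exact_mod_cast Fintype.one_lt_card
  set q : ℝ := ((Fintype.card F : ℕ) : ℝ) with hqdef
  set L := Real.log q with hL
  have hL0 : 0 < L := Real.log_pos hq1
  let H : ℝ → ℝ := fun x => x * Real.log (q - 1) + Real.binEntropy x
  have hHcont : Continuous H := by fun_prop
  have hHδ : qEntropy (Fintype.card F) δ * L = H δ := qEntropy_mul_log Fintype.one_lt_card δ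
  -- A third of the gap pays for replacing `δ` by `⌊δ n⌋ / n`, a third for lower-order terms, and
  -- the last is the decay rate.
  set ε : ℝ := (r - gvBound (Fintype.card F) δ) * L / 3 with hε
  have hε0 : 0 < ε := by
    have := mul_pos (sub_pos.2 hg) hL0
    positivity
  have h3ε : 3 * ε = r * L - L + H δ := by
    rw [hε, ← hHδ, gvBound]; ring
  refine ⟨ε, hε0, ?_⟩
  have hfloor : Tendsto (fun n : ℕ => H ((⌊δ * n⌋₊ : ℝ) / n)) atTop (𝓝 (H δ)) :=
    (hHcont.tendsto δ).comp
      ((tendsto_nat_floor_mul_div_atTop hδ.1.le).comp tendsto_natCast_atTop_atTop)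
  filter_upwards [hfloor.eventually_const_lt (sub_lt_self (H δ) hε0),
    -- In `3/2`, the 1 comes from the exponent `n + 1` and the `1/2` from rounding `r n`.
    eventually_log_succ_add_le hε0 (3 / 2 * L),
    (tendsto_natCast_atTop_atTop.const_mul_atTop hr).eventually_ge_atTop 1,
    (tendsto_natCast_atTop_atTop.const_mul_atTop hδ.1).eventually_ge_atTop 1,
    eventually_ge_atTop 1] with n hH hlog hrn hδn hn
  set w := ⌊δ * n⌋₊ with hw
  have hn0 : (0 : ℝ) < n := by exact_mod_cast hn
  have hkl := (abs_le.1 (hk n)).1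
  have hk0 : 0 < k n := by
    have : (0 : ℝ) < k n := by linarith
    exact_mod_cast this
  have hw0 : 0 < w := Nat.floor_pos.2 hδn
  have hwδ : (w : ℝ) ≤ δ * n := Nat.floor_le (by linarith)
  have hwn : w < n := by
    have : (w : ℝ) < n := by nlinarith [hδ.2]
    exact_mod_cast this
  have hmain := probRelativeDistanceGT_mul_le (F := F) (G := G) hk0 hw0 hwn.le hδ.1.le hwδ
  have hchoose := mul_binEntropy_le_log_choose hw0 hwn
  have hcpos : (0 : ℝ) < n.choose w := by exact_mod_cast Nat.choose_pos hwn.le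
  have hq1' : 0 < q - 1 := by linarith
  rw [← hqdef] at hmain
  have hexp : q ^ k n * (n.choose w * (q - 1) ^ w) =
      Real.exp (k n * L + Real.log (n.choose w) + w * Real.log (q - 1)) := by
    rw [Real.exp_add, Real.exp_add, Real.exp_log hcpos, ← Real.log_pow, ← Real.log_pow,
      Real.exp_log (by positivity), Real.exp_log (by positivity), mul_assoc]
  have hexp' : q ^ (n + 1) = Real.exp ((n + 1) * L) := by
    rw [← Nat.cast_add_one, ← Real.log_pow, Real.exp_log (by positivity)]
  rw [hexp, hexp', ← le_div_iff₀ (Real.exp_pos _), ← Real.exp_sub] at hmain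
  refine hmain.trans (Real.exp_le_exp.2 ?_)
  have hHn : n * H (w / n) = w * Real.log (q - 1) + n * Real.binEntropy (w / n) := by
    simp only [H]; field_simp
  have h1 := mul_lt_mul_of_pos_left hH hn0
  rw [hHn] at h1
  have h2 : (r * n - 1 / 2) * L ≤ k n * L := mul_le_mul_of_nonneg_right (by linarith) hL0.le
  have h3 : 3 * ε * n = r * n * L - n * L + n * H δ := by rw [h3ε]; ring
  linarith

theorem convergesExponentially_zero {r δ : ℝ} (hr : 0 < r)
    (hδ : δ ∈ Set.Ioo (0 : ℝ) 1) {k : ℕ → ℕ} (hk : ∀ n : ℕ, |(k n : ℝ) - r * n| ≤ 1 / 2)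
    (hg : gvBound (Fintype.card F) δ < r) :
    ConvergesExponentially (fun n : ℕ => probRelativeDistanceGT F G (k n) n δ) 0 := by
  obtain ⟨c, hc, hev⟩ := eventually_probRelativeDistanceGT_le (F := F) (G := G) hr hδ hk hg
  obtain ⟨N, hN⟩ := eventually_atTop.1 hev
  -- This constant makes the bound at least 1 for `n ≤ N`, where it holds trivially.
  refine ⟨Real.exp (c * N), c, hc, fun n _ => ?_⟩
  rw [sub_zero, abs_of_nonneg (probRelativeDistanceGT_nonneg _ _ _), ← Real.exp_add]
  rcases le_total N n with h | h
  · refine (hN n h).trans (Real.exp_le_exp.2 ?_)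
    have : 0 ≤ c * N := by positivity
    linarith
  · refine (probRelativeDistanceGT_le_one _ _ _).trans (Real.one_le_exp ?_)
    have : c * n ≤ c * N := mul_le_mul_of_nonneg_left (by exact_mod_cast h) hc.le
    linarith

end Threshold

theorem theorem2p1 {F G : Type*} [Field F] [Fintype F] [DecidableEq F] [CommGroup G] [Fintype G]
    (r δ : ℝ) (hr : r ∈ Set.Ioo (0 : ℝ) 1)
    (hδ : δ ∈ Set.Ioo (0 : ℝ) (1 - (Fintype.card F : ℝ)⁻¹))
    -- `k n` is the integer nearest to `r n` (whatever the rule for breaking ties)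
    (k : ℕ → ℕ) (hk : ∀ n : ℕ, |(k n : ℝ) - r * n| ≤ 1 / 2) :
    (r < gvBound (Fintype.card F) δ →
      Tendsto (fun n : ℕ => probRelativeDistanceGT F G (k n) n δ) atTop (𝓝 1) ∧
      ConvergesExponentially (fun n : ℕ => probRelativeDistanceGT F G (k n) n δ) 1) ∧
    (gvBound (Fintype.card F) δ < r →
      Tendsto (fun n : ℕ => probRelativeDistanceGT F G (k n) n δ) atTop (𝓝 0) ∧
      ConvergesExponentially (fun n : ℕ => probRelativeDistanceGT F G (k n) n δ) 0) := by
  have hδ1 : δ ∈ Set.Ioo (0 : ℝ) 1 := by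
    refine ⟨hδ.1, hδ.2.trans_le (sub_le_self _ ?_)⟩
    positivity
  refine ⟨fun h => ?_, fun h => ?_⟩
  · have := convergesExponentially_one (G := G) hδ hk h
    exact ⟨this.tendsto, this⟩
  · have := convergesExponentially_zero (G := G) hr.1 hδ1 hk h
    exact ⟨this.tendsto, this⟩
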